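/- Let $m,n\ge 0$, $k\ge 1$, $N\ge 1$ be integers, $A\in\mathbb R^{m\times n}$, $b\in\mathbb R^m$, $F\in\mathbb R^{n\times k}$, $\mathcal B\subseteq\{1,\dots,n\}$. Put $$\mathcal X:=\{x\in\mathbb R^n : Ax=b,\ x\ge 0,\ x_j\in\{0,1\}\ \forall j\in\mathcal B\},\qquad v(\xi):=\max\{(F\xi)^Tx : x\in\mathcal X\}\quad(\xi\in\mathbb R^k).$$ Let $\widehat\Xi\subseteq\mathbb R_+\times\mathbb R^{k-1}$ be a closed, convex, full-dimensional cone (i.e. with nonempty interior), and let $\Xi:=\{\xi\in\widehat\Xi:\xi_1=1\}$; thus $\Xi$ is closed and convex. Assume that 1. $\mathcal X$ is nonempty and bounded; 2. $Ax=b,\ x\ge 0$ imply $0\le x_j\le 1$ for all $j\in\mathcal B$; 3. $\Xi$ is nonempty and bounded. Let $\hat\xi_1,\dots,\hat\xi_N\in\Xi$, let $\widehat{\mathbb P}_N:=\frac1N\sum_{i=1}^N\delta_{\hat\xi_i}$, and let $\epsilon>0$. Let $\mathcal M^2(\Xi)$ be the set of probability distributions $\mathbb Q$ supported on $\Xi$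 with $\int_\Xi\|\xi-\xi'\|^2\,d\mathbb Q(\xi)<\infty$ for some $\xi'\in\Xi$, where $\|\cdot\|$ is the Euclidean norm. For $\mathbb Q,\mathbb Q'\in\mathcal M^2(\Xi)$ let $$W(\mathbb Q,\mathbb Q'):=\inf_{\Pi}\Big(\int\|\xi-\xi'\|^2\,\Pi(d\xi,d\xi')\Big)^{1/2},$$ the infimum being over all joint distributions $\Pi$ with marginals $\mathbb Q$ and $\mathbb Q'$. Let $$\mathcal D:=\{\mathbb Q\in\mathcal M^2(\Xi): W(\mathbb Q,\widehat{\mathbb P}_N)\le\epsilon\},\qquad v^+_{\mathcal D}:=\sup_{\mathbb Q\in\mathcal D}\int_\Xi v(\xi)\,d\mathbb Q(\xi).$$ Let $e_1$ be the first standard basis vector of $\mathbb R^k$ and $f_j$ the $j$-th standard basis vector of $\mathbb R^n$. Define $g_1:=\binom{e_1}{0}\in\mathbb R^{k+n}$, $E:=\begin{pmatrix}-be_1^T & A\end{pmatrix}\in\mathbb R^{m\times(k+n)}$, $$H^i(\lambda):=\begin{pmatrix}-\lambda\,(I-\hat\xi_ie_1^T-e_1\hat\xi_i^T+\|\hat\xi_i\|^2e_1e_1^T)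 & \tfrac12F^T\\ \tfrac12F & 0\end{pmatrix},$$ $$Q_j:=\tbinom{0}{f_j}\tbinom{0}{f_j}^T-\tfrac12\tbinom{0}{f_j}\tbinom{e_1}{0}^T-\tfrac12\tbinom{e_1}{0}\tbinom{0}{f_j}^T\quad(j\in\mathcal B),$$ and, for a set $\mathcal K\subseteq\mathbb R^{k+n}$, let $\mathcal{COP}(\mathcal K)$ be the set of symmetric matrices $M$ with $z^TMz\ge 0$ for all $z\in\mathcal K$. Then $v(\xi)$ is finite and attained for every $\xi\in\Xi$, $v$ is integrable on $\Xi$ with respect to every $\mathbb Q\in\mathcal D$, and $v^+_{\mathcal D}$ is finite. There is a scalar $r>0$ such that $\xi^T\xi+x^Tx\le r$ for all $\xi\in\Xi$, $x\in\mathcal X$; and for every such $r$, the number $v^+_{\mathcal D}$ equals the optimal value (infimum) of the generalized copositive program $$\begin{array}{ll}\inf & \lambda\epsilon^2+\frac1N\sum_{i=1}^N(\alpha^i+r\rho^i)\\[2pt] \text{s.t.} & \alpha^ig_1g_1^T-H^i(\lambda)+E^T\mathrm{Diag}(u^i)E+\sum_{j\in\mathcal B}v^i_jQ_j+\rho^iI\in\mathcal{COP}(\widehat\Xi\times\mathbb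 R^n_+)\quad\forall i\in\{1,\dots,N\},\\[2pt] & \rho^i\ge 0\quad\forall i\in\{1,\dots,N\},\qquad \lambda\ge 0,\end{array}$$ in the variables $\lambda\in\mathbb R$ and $\alpha^i,\rho^i\in\mathbb R$, $u^i\in\mathbb R^m$, $v^i\in\mathbb R^{\mathcal B}$ for $i=1,\dots,N$. In particular this program is feasible and bounded below. -/

import Mathlib

open MeasureTheory
open scoped Matrix ENNReal

noncomputable section

namespace WassersteinCop

/-- The slice `Ξ = {ξ ∈ Ξ̂ : ξ₁ = 1}` of the cone `Ξ̂` (the first coordinate has index `0`). -/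
def supportSet {k : ℕ} [NeZero k] (C : ProperCone ℝ (EuclideanSpace ℝ (Fin k))) :
    Set (EuclideanSpace ℝ (Fin k)) :=
  {ξ | ξ ∈ C ∧ ξ 0 = 1}

/-- The mixed 0-1 feasible set `X = {x : A x = b, x ≥ 0, x_j ∈ {0,1} for j ∈ B}`. -/
def feasibleSet {m n : ℕ} (A : Matrix (Fin m) (Fin n) ℝ) (b : Fin m → ℝ)
    (B : Finset (Fin n)) : Set (Fin n → ℝ) :=
  {x | A *ᵥ x = b ∧ 0 ≤ x ∧ ∀ j ∈ B, x j = 0 ∨ x j = 1}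

/-- The set of objective values `(F ξ)ᵀ x`, `x ∈ X`, of the mixed 0-1 program. -/
def objectiveValues {m n k : ℕ} (A : Matrix (Fin m) (Fin n) ℝ) (b : Fin m → ℝ)
    (B : Finset (Fin n)) (F : Matrix (Fin n) (Fin k) ℝ) (ξ : EuclideanSpace ℝ (Fin k)) : Set ℝ :=
  (fun x : Fin n → ℝ => (F *ᵥ ξ.ofLp) ⬝ᵥ x) '' feasibleSet A b B

/-- The optimal value `v(ξ) = max {(F ξ)ᵀ x : x ∈ X}`. -/
def optValue {m n k : ℕ} (A : Matrix (Fin m) (Fin n) ℝ) (b : Fin m → ℝ)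
    (B : Finset (Fin n)) (F : Matrix (Fin n) (Fin k) ℝ) (ξ : EuclideanSpace ℝ (Fin k)) : ℝ :=
  sSup (objectiveValues A b B F ξ)

/-- `M²(Ξ)`: probability distributions supported on `Ξ` with finite second moment about some
reference point of `Ξ`. -/
def finiteSecondMoment {k : ℕ} (Ξ : Set (EuclideanSpace ℝ (Fin k))) :
    Set (Measure (EuclideanSpace ℝ (Fin k))) :=
  {Q | IsProbabilityMeasure Q ∧ Q Ξᶜ = 0 ∧ ∃ ξ' ∈ Ξ, ∫⁻ ξ, ‖ξ - ξ'‖ₑ ^ 2 ∂Q < ∞}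

/-- The 2-Wasserstein distance: the infimum of `(∫ ‖ξ - ξ'‖² dγ)^(1/2)` over all joint
distributions `γ` with marginals `Q` and `Q'`. -/
def wasserstein {k : ℕ} (Q Q' : Measure (EuclideanSpace ℝ (Fin k))) : ℝ≥0∞ :=
  ⨅ γ ∈ {γ : Measure (EuclideanSpace ℝ (Fin k) × EuclideanSpace ℝ (Fin k)) |
      γ.map Prod.fst = Q ∧ γ.map Prod.snd = Q'},
    (∫⁻ p, ‖p.1 - p.2‖ₑ ^ 2 ∂γ) ^ (1 / 2 : ℝ)

/-- The uniform empirical distribution `(1/N) ∑ᵢ δ_{ξ̂ᵢ}`. -/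
def empirical {k N : ℕ} (ξs : Fin N → EuclideanSpace ℝ (Fin k)) :
    Measure (EuclideanSpace ℝ (Fin k)) :=
  (N : ℝ≥0∞)⁻¹ • ∑ i, Measure.dirac (ξs i)

/-- The ambiguity set: the 2-Wasserstein ball in `M²(Ξ)` of radius `ε` around the empirical
distribution. -/
def ambiguitySet {k N : ℕ} (Ξ : Set (EuclideanSpace ℝ (Fin k)))
    (ξs : Fin N → EuclideanSpace ℝ (Fin k)) (ε : ℝ) : Set (Measure (EuclideanSpace ℝ (Fin k))) :=
  {Q | Q ∈ finiteSecondMoment Ξ ∧ wasserstein Q (empirical ξs) ≤ ENNReal.ofReal ε}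

/-- The expected optimal values `v_Q = ∫_Ξ v(ξ) dQ(ξ)`, for `Q` in the ambiguity set. -/
def expectedValues {m n k N : ℕ} (A : Matrix (Fin m) (Fin n) ℝ) (b : Fin m → ℝ)
    (B : Finset (Fin n)) (F : Matrix (Fin n) (Fin k) ℝ) (Ξ : Set (EuclideanSpace ℝ (Fin k)))
    (ξs : Fin N → EuclideanSpace ℝ (Fin k)) (ε : ℝ) : Set ℝ :=
  (fun Q : Measure (EuclideanSpace ℝ (Fin k)) => ∫ ξ in Ξ, optValue A b B F ξ ∂Q) ''
    ambiguitySet Ξ ξs ε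

/-- The worst-case expected optimal value, the supremum of `v_Q` over the ambiguity set. -/
def worstCaseValue {m n k N : ℕ} (A : Matrix (Fin m) (Fin n) ℝ) (b : Fin m → ℝ)
    (B : Finset (Fin n)) (F : Matrix (Fin n) (Fin k) ℝ) (Ξ : Set (EuclideanSpace ℝ (Fin k)))
    (ξs : Fin N → EuclideanSpace ℝ (Fin k)) (ε : ℝ) : ℝ :=
  sSup (expectedValues A b B F Ξ ξs ε)

/-- The copositive cone `COP(K)`. -/
def copositiveCone {ι : Type*} [Fintype ι] (K : Set (ι → ℝ)) : Set (Matrix ι ι ℝ) :=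
  {M | M.IsSymm ∧ ∀ z ∈ K, 0 ≤ z ⬝ᵥ (M *ᵥ z)}

/-- The cone `Ξ̂ × ℝⁿ₊`, in the space of vectors `z = (ξ, x)`. -/
def productCone {k : ℕ} (n : ℕ) (C : ProperCone ℝ (EuclideanSpace ℝ (Fin k))) :
    Set (Fin k ⊕ Fin n → ℝ) :=
  {z | ∃ ξ ∈ C, ∃ x : Fin n → ℝ, 0 ≤ x ∧ z = Sum.elim ξ.ofLp x}

/-- The first standard basis vector `e₁` of `ℝᵏ`. -/
def e₁ (k : ℕ) [NeZero k] : Fin k → ℝ := Pi.single 0 1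

/-- `g₁ = (e₁, 0)`. -/
def g₁ (k n : ℕ) [NeZero k] : Fin k ⊕ Fin n → ℝ := Sum.elim (e₁ k) 0

/-- The vector `(0, f_j)`, where `f_j` is the `j`-th standard basis vector of `ℝⁿ`. -/
def f₀ (k : ℕ) {n : ℕ} (j : Fin n) : Fin k ⊕ Fin n → ℝ := Sum.elim 0 (Pi.single j 1)

/-- `E = (-b e₁ᵀ  A)`. -/
def matE {m n : ℕ} (k : ℕ) [NeZero k] (A : Matrix (Fin m) (Fin n) ℝ) (b : Fin m → ℝ) :
    Matrix (Fin m) (Fin k ⊕ Fin n) ℝ :=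
  Matrix.fromCols (-Matrix.vecMulVec b (e₁ k)) A

/-- `H(λ)` for the sample `η`: the upper left block is
`-λ (I - η e₁ᵀ - e₁ ηᵀ + ‖η‖² e₁ e₁ᵀ)`, the off-diagonal blocks are `½ Fᵀ` and `½ F`. -/
def matH {k n : ℕ} [NeZero k] (F : Matrix (Fin n) (Fin k) ℝ) (η : EuclideanSpace ℝ (Fin k))
    (lam : ℝ) : Matrix (Fin k ⊕ Fin n) (Fin k ⊕ Fin n) ℝ :=
  Matrix.fromBlocks
    (-lam • (1 - Matrix.vecMulVec η.ofLp (e₁ k) - Matrix.vecMulVec (e₁ k) η.ofLp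
      + ‖η‖ ^ 2 • Matrix.vecMulVec (e₁ k) (e₁ k)))
    ((1 / 2 : ℝ) • Fᵀ) ((1 / 2 : ℝ) • F) 0

/-- `Q_j = (0,f_j)(0,f_j)ᵀ - ½ (0,f_j)(e₁,0)ᵀ - ½ (e₁,0)(0,f_j)ᵀ`. -/
def matQ (k : ℕ) {n : ℕ} [NeZero k] (j : Fin n) : Matrix (Fin k ⊕ Fin n) (Fin k ⊕ Fin n) ℝ :=
  Matrix.vecMulVec (f₀ k j) (f₀ k j) - (1 / 2 : ℝ) • Matrix.vecMulVec (f₀ k j) (g₁ k n)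
    - (1 / 2 : ℝ) • Matrix.vecMulVec (g₁ k n) (f₀ k j)

/-- The decision variables `λ ∈ ℝ` and `αⁱ, ρⁱ ∈ ℝ`, `uⁱ ∈ ℝᵐ`, `vⁱ ∈ ℝ^B` for `i ∈ [N]`. -/
structure CopVars (m N : ℕ) {n : ℕ} (B : Finset (Fin n)) where
  lam : ℝ
  α : Fin N → ℝ
  ρ : Fin N → ℝ
  u : Fin N → Fin m → ℝ
  v : Fin N → B → ℝ

/-- The `i`-th matrix
`αⁱ g₁ g₁ᵀ - Hⁱ(λ) + Eᵀ Diag(uⁱ) E + ∑_{j ∈ B} vⁱ_j Q_j + ρⁱ I` of the copositive program. -/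
def copMatrix {m n k N : ℕ} [NeZero k] (A : Matrix (Fin m) (Fin n) ℝ) (b : Fin m → ℝ)
    (B : Finset (Fin n)) (F : Matrix (Fin n) (Fin k) ℝ)
    (ξs : Fin N → EuclideanSpace ℝ (Fin k)) (y : CopVars m N B) (i : Fin N) :
    Matrix (Fin k ⊕ Fin n) (Fin k ⊕ Fin n) ℝ :=
  y.α i • Matrix.vecMulVec (g₁ k n) (g₁ k n) - matH F (ξs i) y.lam
    + (matE k A b)ᵀ * Matrix.diagonal (y.u i) * matE k A b
    + ∑ j : B, y.v i j • matQ k (j : Fin n) + y.ρ i • 1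

/-- The feasible set of the copositive program. -/
def copFeasible {m n k N : ℕ} [NeZero k] (A : Matrix (Fin m) (Fin n) ℝ) (b : Fin m → ℝ)
    (B : Finset (Fin n)) (F : Matrix (Fin n) (Fin k) ℝ)
    (C : ProperCone ℝ (EuclideanSpace ℝ (Fin k))) (ξs : Fin N → EuclideanSpace ℝ (Fin k)) :
    Set (CopVars m N B) :=
  {y | (∀ i, copMatrix A b B F ξs y i ∈ copositiveCone (productCone n C)) ∧
    (∀ i, 0 ≤ y.ρ i) ∧ 0 ≤ y.lam}

/-- The objective `λ ε² + (1/N) ∑ᵢ (αⁱ + r ρⁱ)` of the copositive program. -/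
def copObjective {m n N : ℕ} {B : Finset (Fin n)} (ε r : ℝ) (y : CopVars m N B) : ℝ :=
  y.lam * ε ^ 2 + (1 / (N : ℝ)) * ∑ i, (y.α i + r * y.ρ i)

/-- The constraint `ξᵀξ + xᵀx ≤ r` is redundant on `Ξ × X`. -/
def RedundantBound {k n : ℕ} (Ξ : Set (EuclideanSpace ℝ (Fin k))) (X : Set (Fin n → ℝ))
    (r : ℝ) : Prop :=
  ∀ ξ ∈ Ξ, ∀ x ∈ X, ξ.ofLp ⬝ᵥ ξ.ofLp + x ⬝ᵥ x ≤ r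

end WassersteinCop

end

/-!
The proof splits the claim into duality for the Wasserstein ball and exactness of the copositive
program for a fixed multiplier `λ`. Both are expressed through the envelope
`h_λ(η) = max {v(ξ) - λ ‖ξ - η‖² : ξ ∈ Ξ}`, which is attained because `X` and `Ξ` are compact and
`v`, a maximum of bilinear functions over `X`, is continuous.

*Wasserstein duality.* Integrating `v(ξ) ≤ λ ‖ξ - ξ'‖² + h_λ(ξ')` over nearly optimal couplings
bounds the worst case by `λ ε² + (1/N) ∑ᵢ h_λ(ξ̂ᵢ)` (`integral_le_dual`). Conversely, the pairs
(transport cost, expectation of `v`) of plans with second marginal the empirical distribution form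
a convex subset of the plane that misses the quadrant `cost < ε²`, `value > worst case`. A
separating line is not vertical because the cost `0` is attained, and its slope is a `λ ≥ 0` at
which the bound is tight (`exists_multiplier`).

*Copositive program.* On `z = (ξ, x)` with `ξ₁ = 1` and `x ∈ X` the constraint terms of the matrix
vanish, so feasibility gives `h_λ(ξ̂ᵢ) ≤ αᵢ + r ρᵢ` (`envelope_le_of_copFeasible`). Conversely, if
`αᵢ > h_λ(ξ̂ᵢ)`, then `ρ = 0` and sufficiently large penalties on the binary conditions and on
`A x = ξ₁ b` make the quadratic form positive on the cone (`exists_penalties`). This is a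
compactness argument on the unit sphere: the cone contains no nonzero point with `A x = ξ₁ b` and
`ξ₁ = 0`, because `Ξ` and the relaxation of `X` have no recession directions.
-/

namespace WassersteinCop

open Matrix Set Filter Topology

/-! ### The quadratic forms of the copositive program -/

theorem dotProduct_vecMulVec_mulVec_self {ι : Type*} [Fintype ι] (a c z : ι → ℝ) :
    z ⬝ᵥ (vecMulVec a c *ᵥ z) = (a ⬝ᵥ z) * (c ⬝ᵥ z) := by
  rw [vecMulVec_mulVec, op_smul_eq_smul, dotProduct_smul, smul_eq_mul, dotProduct_comm z a, mul_comm]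

theorem e₁_dotProduct {k : ℕ} [NeZero k] (ξ : Fin k → ℝ) : e₁ k ⬝ᵥ ξ = ξ 0 := by
  simp [e₁]

theorem g₁_dotProduct {k n : ℕ} [NeZero k] (ξ : Fin k → ℝ) (x : Fin n → ℝ) :
    g₁ k n ⬝ᵥ Sum.elim ξ x = ξ 0 := by
  simp [g₁, sumElim_dotProduct_sumElim, e₁_dotProduct]

theorem f₀_dotProduct {k n : ℕ} (j : Fin n) (ξ : Fin k → ℝ) (x : Fin n → ℝ) :
    f₀ k j ⬝ᵥ Sum.elim ξ x = x j := by
  simp [f₀]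

theorem quadForm_matQ {k n : ℕ} [NeZero k] (j : Fin n) (ξ : Fin k → ℝ) (x : Fin n → ℝ) :
    Sum.elim ξ x ⬝ᵥ (matQ k j *ᵥ Sum.elim ξ x) = x j ^ 2 - x j * ξ 0 := by
  simp only [matQ, sub_mulVec, smul_mulVec, dotProduct_sub, dotProduct_smul,
    dotProduct_vecMulVec_mulVec_self, g₁_dotProduct, f₀_dotProduct, smul_eq_mul]
  ring

theorem matE_mulVec {m n k : ℕ} [NeZero k] (A : Matrix (Fin m) (Fin n) ℝ) (b : Fin m → ℝ)
    (ξ : Fin k → ℝ) (x : Fin n → ℝ) :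
    matE k A b *ᵥ Sum.elim ξ x = A *ᵥ x - ξ 0 • b := by
  rw [matE, fromCols_mulVec_sumElim, neg_mulVec, vecMulVec_mulVec, op_smul_eq_smul, e₁_dotProduct]
  abel

theorem quadForm_matH {n k : ℕ} [NeZero k] (F : Matrix (Fin n) (Fin k) ℝ)
    (η ξ : EuclideanSpace ℝ (Fin k)) (x : Fin n → ℝ) (lam : ℝ) :
    Sum.elim ξ.ofLp x ⬝ᵥ (matH F η lam *ᵥ Sum.elim ξ.ofLp x) =
      (F *ᵥ ξ.ofLp) ⬝ᵥ x - lam * ‖ξ - ξ 0 • η‖ ^ 2 := by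
  have hinner (a c : EuclideanSpace ℝ (Fin k)) : inner ℝ a c = c.ofLp ⬝ᵥ a.ofLp := by
    simp [EuclideanSpace.inner_eq_star_dotProduct]
  have h1 : ‖ξ - ξ 0 • η‖ ^ 2 =
      ξ.ofLp ⬝ᵥ ξ.ofLp - 2 * (ξ 0 * (η.ofLp ⬝ᵥ ξ.ofLp)) + ξ 0 ^ 2 * ‖η‖ ^ 2 := by
    rw [norm_sub_sq_real, norm_smul, mul_pow, Real.norm_eq_abs, sq_abs, inner_smul_right, hinner,
      ← real_inner_self_eq_norm_sq, hinner]
  have h2 : ξ.ofLp ⬝ᵥ (Fᵀ *ᵥ x) = (F *ᵥ ξ.ofLp) ⬝ᵥ x := by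
    rw [dotProduct_mulVec, vecMul_transpose]
  have h3 : x ⬝ᵥ (F *ᵥ ξ.ofLp) = (F *ᵥ ξ.ofLp) ⬝ᵥ x := dotProduct_comm _ _
  rw [h1, matH, fromBlocks_mulVec, sumElim_dotProduct_sumElim]
  simp only [Sum.elim_comp_inl, Sum.elim_comp_inr, smul_mulVec, add_mulVec, sub_mulVec,
    dotProduct_add, dotProduct_sub, dotProduct_smul, one_mulVec, zero_mulVec,
    dotProduct_vecMulVec_mulVec_self, e₁_dotProduct, smul_eq_mul, h2, h3, add_zero]
  ring

/-- The quadratic form of the `i`-th constraint matrix at `z = (ξ, x)`. On the slice `ξ₁ = 1` the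
constraint terms vanish at every feasible `x`. -/
theorem quadForm_copMatrix {m n k N : ℕ} [NeZero k] (A : Matrix (Fin m) (Fin n) ℝ)
    (b : Fin m → ℝ) (B : Finset (Fin n)) (F : Matrix (Fin n) (Fin k) ℝ)
    (ξs : Fin N → EuclideanSpace ℝ (Fin k)) (y : CopVars m N B) (i : Fin N)
    (ξ : EuclideanSpace ℝ (Fin k)) (x : Fin n → ℝ) :
    Sum.elim ξ.ofLp x ⬝ᵥ (copMatrix A b B F ξs y i *ᵥ Sum.elim ξ.ofLp x) =
      y.α i * ξ 0 ^ 2 - ((F *ᵥ ξ.ofLp) ⬝ᵥ x - y.lam * ‖ξ - ξ 0 • ξs i‖ ^ 2)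
      + ∑ l, y.u i l * ((A *ᵥ x) l - ξ 0 * b l) ^ 2
      + ∑ j : B, y.v i j * (x j ^ 2 - x j * ξ 0)
      + y.ρ i * (ξ.ofLp ⬝ᵥ ξ.ofLp + x ⬝ᵥ x) := by
  have hE : Sum.elim ξ.ofLp x ⬝ᵥ (((matE k A b)ᵀ * diagonal (y.u i) * matE k A b) *ᵥ
      Sum.elim ξ.ofLp x) = ∑ l, y.u i l * ((A *ᵥ x) l - ξ 0 * b l) ^ 2 := by
    rw [← mulVec_mulVec, ← mulVec_mulVec, dotProduct_mulVec, vecMul_transpose, matE_mulVec]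
    simp only [dotProduct, mulVec_diagonal, Pi.sub_apply, Pi.smul_apply, smul_eq_mul]
    exact Finset.sum_congr rfl fun l _ => by ring
  simp only [copMatrix, add_mulVec, sub_mulVec, smul_mulVec, dotProduct_add, dotProduct_sub,
    dotProduct_smul, dotProduct_vecMulVec_mulVec_self, g₁_dotProduct, quadForm_matH, hE,
    sum_mulVec, dotProduct_sum, quadForm_matQ, one_mulVec, sumElim_dotProduct_sumElim, smul_eq_mul]
  ring

theorem isSymm_copMatrix {m n k N : ℕ} [NeZero k] (A : Matrix (Fin m) (Fin n) ℝ)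
    (b : Fin m → ℝ) (B : Finset (Fin n)) (F : Matrix (Fin n) (Fin k) ℝ)
    (ξs : Fin N → EuclideanSpace ℝ (Fin k)) (y : CopVars m N B) (i : Fin N) :
    (copMatrix A b B F ξs y i).IsSymm := by
  have hQ (j : Fin n) : (matQ k j)ᵀ = matQ k j := by
    simp only [matQ, transpose_sub, transpose_smul, transpose_vecMulVec]
    abel
  have hH : (matH F (ξs i) y.lam)ᵀ = matH F (ξs i) y.lam := by
    simp only [matH, fromBlocks_transpose, transpose_smul, transpose_add, transpose_sub,
      transpose_vecMulVec, transpose_one, transpose_transpose, transpose_zero]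
    congr 3
    abel
  simp only [Matrix.IsSymm, copMatrix, transpose_add, transpose_sub, transpose_smul,
    transpose_vecMulVec, hH, transpose_mul, transpose_transpose, diagonal_transpose,
    transpose_sum, hQ, transpose_one, Matrix.mul_assoc]

/-! ### Exact penalties on compact sets -/

/-- If `f` is positive wherever the nonnegative penalty `g` vanishes on a compact set, then
`f + t g` is positive on the whole set for some `t`. -/
theorem exists_penalty {Z : Type*} [TopologicalSpace Z] {S : Set Z} (hS : IsCompact S)
    {f g : Z → ℝ} (hf : Continuous f) (hg : Continuous g) (hg0 : ∀ z ∈ S, 0 ≤ g z)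
    (hfg : ∀ z ∈ S, g z = 0 → 0 < f z) : ∃ t : ℝ, 0 ≤ t ∧ ∀ z ∈ S, 0 < f z + t * g z := by
  rcases S.eq_empty_or_nonempty with rfl | hne
  · exact ⟨0, le_rfl, by simp⟩
  rcases (S ∩ {z | f z ≤ 0}).eq_empty_or_nonempty with he | hne'
  · refine ⟨0, le_rfl, fun z hz => ?_⟩
    by_contra! h
    exact he.le ⟨hz, by simpa using h⟩
  have hS' : IsCompact (S ∩ {z | f z ≤ 0}) := hS.inter_right (isClosed_le hf continuous_const)
  obtain ⟨p, hp, hpmin⟩ := hS'.exists_isMinOn hne' hg.continuousOn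
  obtain ⟨q, hq, hqmin⟩ := hS.exists_isMinOn hne hf.continuousOn
  have hgp : 0 < g p := lt_of_le_of_ne (hg0 p hp.1) fun h =>
    absurd (hfg p hp.1 h.symm) (not_lt.2 hp.2)
  have ht : 0 ≤ (|f q| + 1) / g p := by positivity
  refine ⟨(|f q| + 1) / g p, ht, fun z hz => ?_⟩
  by_cases hfz : f z ≤ 0
  · have h1 : g p ≤ g z := hpmin ⟨hz, hfz⟩
    have h2 : f q ≤ f z := hqmin hz
    have h3 : |f q| + 1 ≤ (|f q| + 1) / g p * g z := by
      rw [div_mul_eq_mul_div, le_div_iff₀ hgp]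
      exact mul_le_mul_of_nonneg_left h1 (by positivity)
    linarith [neg_abs_le (f q)]
  · have := mul_nonneg ht (hg0 z hz)
    linarith

section Inner

/-! ### Recession directions -/

theorem eq_zero_of_bounded_ray {E : Type*} [NormedAddCommGroup E] [NormedSpace ℝ E] {S : Set E}
    (hS : Bornology.IsBounded S) {p d : E} (h : ∀ t : ℝ, 0 ≤ t → p + t • d ∈ S) : d = 0 := by
  obtain ⟨R, hR⟩ := hS.exists_norm_le
  by_contra hd
  have hd' : 0 < ‖d‖ := norm_pos_iff.2 hd
  have hR0 : 0 ≤ R := (norm_nonneg _).trans (hR _ (h 0 le_rfl))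
  have ht : 0 ≤ (R + ‖p‖ + 1) / ‖d‖ := by positivity
  have h1 := hR _ (h _ ht)
  have h2 : ‖((R + ‖p‖ + 1) / ‖d‖) • d‖ = R + ‖p‖ + 1 := by
    rw [norm_smul, Real.norm_of_nonneg ht, div_mul_cancel₀ _ hd'.ne']
  have h3 := norm_sub_le (p + ((R + ‖p‖ + 1) / ‖d‖) • d) p
  rw [add_sub_cancel_left, h2] at h3
  linarith

variable {m n k : ℕ}

/-- A bounded slice `ξ₁ = 1` forces the cone to meet the hyperplane `ξ₁ = 0` only in `0`. -/
theorem eq_zero_of_mem_cone [NeZero k] {C : ProperCone ℝ (EuclideanSpace ℝ (Fin k))}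
    (hne : (supportSet C).Nonempty) (hbdd : Bornology.IsBounded (supportSet C))
    {ξ : EuclideanSpace ℝ (Fin k)} (hξ : ξ ∈ C) (h0 : ξ 0 = 0) : ξ = 0 := by
  obtain ⟨p, hp, hp1⟩ := hne
  refine eq_zero_of_bounded_ray hbdd (p := p) fun t ht => ⟨?_, by simp [h0, hp1]⟩
  exact C.add_mem hp (C.smul_mem hξ ht)

/-- The relaxation `{x : A x = b, x ≥ 0}` has no nonzero recession direction: such a direction
vanishes on the binary coordinates, hence is a recession direction of the bounded set `X`. -/
theorem eq_zero_of_mulVec_eq_zero {A : Matrix (Fin m) (Fin n) ℝ} {b : Fin m → ℝ}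
    {B : Finset (Fin n)} (hne : (feasibleSet A b B).Nonempty)
    (hbdd : Bornology.IsBounded (feasibleSet A b B))
    (hB : ∀ x : Fin n → ℝ, A *ᵥ x = b → 0 ≤ x → ∀ j ∈ B, 0 ≤ x j ∧ x j ≤ 1)
    {d : Fin n → ℝ} (hd : A *ᵥ d = 0) (hd0 : 0 ≤ d) : d = 0 := by
  obtain ⟨p, hpA, hp0, hpB⟩ := hne
  have hray (t : ℝ) (ht : 0 ≤ t) : A *ᵥ (p + t • d) = b ∧ 0 ≤ p + t • d :=
    ⟨by rw [mulVec_add, mulVec_smul, hd, hpA, smul_zero, add_zero],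
      add_nonneg hp0 (smul_nonneg ht hd0)⟩
  have hdB (j : Fin n) (hj : j ∈ B) : d j = 0 := by
    refine eq_zero_of_bounded_ray (Metric.isBounded_Icc (0 : ℝ) 1) (p := p j) fun t ht => ?_
    exact hB _ (hray t ht).1 (hray t ht).2 j hj
  refine eq_zero_of_bounded_ray hbdd (p := p) fun t ht =>
    ⟨(hray t ht).1, (hray t ht).2, fun j hj => ?_⟩
  simpa [hdB j hj] using hpB j hj

/-! ### The inner problem -/

theorem isCompact_feasibleSet {A : Matrix (Fin m) (Fin n) ℝ} {b : Fin m → ℝ}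
    {B : Finset (Fin n)} (hbdd : Bornology.IsBounded (feasibleSet A b B)) :
    IsCompact (feasibleSet A b B) := by
  refine Metric.isCompact_of_isClosed_isBounded ?_ hbdd
  have : feasibleSet A b B = {x | A *ᵥ x = b} ∩ ({x | 0 ≤ x} ∩
      ⋂ j ∈ B, {x : Fin n → ℝ | x j = 0} ∪ {x | x j = 1}) := by
    ext x
    simp [feasibleSet]
  rw [this]
  refine (isClosed_eq (by fun_prop) continuous_const).inter
    ((isClosed_le continuous_const continuous_id).inter (isClosed_biInter fun j _ => ?_))
  exact (isClosed_eq (by fun_prop) continuous_const).union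
    (isClosed_eq (by fun_prop) continuous_const)

theorem isCompact_supportSet [NeZero k] {C : ProperCone ℝ (EuclideanSpace ℝ (Fin k))}
    (hbdd : Bornology.IsBounded (supportSet C)) : IsCompact (supportSet C) :=
  Metric.isCompact_of_isClosed_isBounded
    (C.isClosed.inter (isClosed_eq (by fun_prop) continuous_const)) hbdd

theorem continuous_objective (F : Matrix (Fin n) (Fin k) ℝ) :
    Continuous fun p : EuclideanSpace ℝ (Fin k) × (Fin n → ℝ) => (F *ᵥ p.1.ofLp) ⬝ᵥ p.2 := by
  fun_prop

theorem isGreatest_optValue {A : Matrix (Fin m) (Fin n) ℝ} {b : Fin m → ℝ}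
    {B : Finset (Fin n)} (hne : (feasibleSet A b B).Nonempty)
    (hbdd : Bornology.IsBounded (feasibleSet A b B)) (F : Matrix (Fin n) (Fin k) ℝ)
    (ξ : EuclideanSpace ℝ (Fin k)) :
    IsGreatest (objectiveValues A b B F ξ) (optValue A b B F ξ) :=
  ((isCompact_feasibleSet hbdd).image
    ((continuous_objective F).comp (by fun_prop : Continuous fun x : Fin n → ℝ => (ξ, x)))
    ).isGreatest_sSup (hne.image _)

theorem continuous_optValue {A : Matrix (Fin m) (Fin n) ℝ} {b : Fin m → ℝ}
    {B : Finset (Fin n)} (hbdd : Bornology.IsBounded (feasibleSet A b B))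
    (F : Matrix (Fin n) (Fin k) ℝ) : Continuous (optValue A b B F) :=
  (isCompact_feasibleSet hbdd).continuous_sSup
    (f := fun (ξ : EuclideanSpace ℝ (Fin k)) x => (F *ᵥ ξ.ofLp) ⬝ᵥ x) (continuous_objective F)

theorem exists_redundantBound {E : Set (Fin n → ℝ)} {Ξ : Set (EuclideanSpace ℝ (Fin k))}
    (hΞ : IsCompact Ξ) (hE : IsCompact E) : ∃ r : ℝ, 0 < r ∧ RedundantBound Ξ E r := by
  have hc : Continuous fun p : EuclideanSpace ℝ (Fin k) × (Fin n → ℝ) =>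
      p.1.ofLp ⬝ᵥ p.1.ofLp + p.2 ⬝ᵥ p.2 := by fun_prop
  obtain ⟨R, hR⟩ := (hΞ.prod hE).exists_bound_of_continuousOn hc.continuousOn
  refine ⟨max R 1, by positivity, fun ξ hξ x hx => ?_⟩
  exact (le_abs_self _).trans ((hR (ξ, x) ⟨hξ, hx⟩).trans (le_max_left _ _))

end Inner

/-! ### Duality for the Wasserstein ball -/

section Wasserstein

variable {k N : ℕ} {v : EuclideanSpace ℝ (Fin k) → ℝ} {Ξ : Set (EuclideanSpace ℝ (Fin k))}
  {ξs : Fin N → EuclideanSpace ℝ (Fin k)} {ε lam : ℝ}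

/-- The Moreau-type envelope `η ↦ sup {v(ξ) - λ ‖ξ - η‖² : ξ ∈ Ξ}` of the integrand. -/
noncomputable def envelope (v : EuclideanSpace ℝ (Fin k) → ℝ)
    (Ξ : Set (EuclideanSpace ℝ (Fin k))) (lam : ℝ) (η : EuclideanSpace ℝ (Fin k)) : ℝ :=
  sSup ((fun ξ => v ξ - lam * ‖ξ - η‖ ^ 2) '' Ξ)

theorem continuous_envelope (hv : Continuous v) (hΞ : IsCompact Ξ) :
    Continuous (envelope v Ξ lam) :=
  hΞ.continuous_sSup (f := fun η ξ => v ξ - lam * ‖ξ - η‖ ^ 2) (by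
    change Continuous fun p : EuclideanSpace ℝ (Fin k) × EuclideanSpace ℝ (Fin k) =>
      v p.2 - lam * ‖p.2 - p.1‖ ^ 2
    fun_prop)

theorem isGreatest_envelope (hv : Continuous v) (hΞ : IsCompact Ξ) (hne : Ξ.Nonempty)
    (η : EuclideanSpace ℝ (Fin k)) :
    IsGreatest ((fun ξ => v ξ - lam * ‖ξ - η‖ ^ 2) '' Ξ) (envelope v Ξ lam η) :=
  (hΞ.image (by fun_prop)).isGreatest_sSup (hne.image _)

theorem lintegral_empirical (f : EuclideanSpace ℝ (Fin k) → ℝ≥0∞) :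
    ∫⁻ ξ, f ξ ∂(empirical ξs) = (N : ℝ≥0∞)⁻¹ * ∑ i, f (ξs i) := by
  simp [empirical, lintegral_smul_measure, lintegral_finsetSum_measure]

theorem isProbabilityMeasure_empirical (hN : 0 < N) : IsProbabilityMeasure (empirical ξs) := by
  constructor
  have := lintegral_empirical (ξs := ξs) (fun _ => 1)
  simp only [lintegral_one, Finset.sum_const, Finset.card_univ, Fintype.card_fin,
    nsmul_eq_mul, mul_one] at this
  rw [this, ENNReal.inv_mul_cancel (by exact_mod_cast hN.ne') (by simp)]

/-- The uniform distribution on the pairs `(ζᵢ, ξ̂ᵢ)`. -/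
noncomputable def pairing (ζ ξs : Fin N → EuclideanSpace ℝ (Fin k)) :
    Measure (EuclideanSpace ℝ (Fin k) × EuclideanSpace ℝ (Fin k)) :=
  (N : ℝ≥0∞)⁻¹ • ∑ i, Measure.dirac (ζ i, ξs i)

theorem map_pairing {β : Type*} [MeasurableSpace β]
    {f : EuclideanSpace ℝ (Fin k) × EuclideanSpace ℝ (Fin k) → β} (hf : Measurable f)
    (ζ ξs : Fin N → EuclideanSpace ℝ (Fin k)) :
    (pairing ζ ξs).map f = (N : ℝ≥0∞)⁻¹ • ∑ i, Measure.dirac (f (ζ i, ξs i)) := by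
  rw [pairing, Measure.map_smul, Measure.map_finset_sum hf.aemeasurable]
  simp [Measure.map_dirac' hf]

theorem integral_smul_sum_dirac {α : Type*} [MeasurableSpace α] [MeasurableSingletonClass α]
    (p : Fin N → α) (f : α → ℝ) :
    ∫ a, f a ∂((N : ℝ≥0∞)⁻¹ • ∑ i, Measure.dirac (p i)) = 1 / (N : ℝ) * ∑ i, f (p i) := by
  rw [integral_smul_measure, integral_finsetSum_measure fun i _ => integrable_dirac (by simp)]
  simp

theorem ae_mem_of_map_eq {α β : Type*} [MeasurableSpace α] [MeasurableSpace β] {γ : Measure α}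
    {f : α → β} (hf : Measurable f) {Q : Measure β} (h : γ.map f = Q) {s : Set β}
    (hs : MeasurableSet s) (hQ : Q sᶜ = 0) : ∀ᵐ p ∂γ, f p ∈ s := by
  subst h
  rw [Measure.map_apply hf hs.compl] at hQ
  exact hQ

theorem enorm_sq_eq_ofReal_norm_sq {E : Type*} [NormedAddCommGroup E] (x : E) :
    ‖x‖ₑ ^ 2 = ENNReal.ofReal (‖x‖ ^ 2) := by
  rw [ENNReal.ofReal_pow (norm_nonneg _), ofReal_norm]

/-- The worst-case expectation is bounded by the Lagrangian dual objective, for every multiplier: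
integrate `v(ξ) ≤ λ ‖ξ - ξ'‖² + envelope(ξ')` over nearly optimal couplings. -/
theorem integral_le_dual (hv : Continuous v) (hΞ : IsCompact Ξ) (hne : Ξ.Nonempty) (hlam : 0 ≤ lam)
    (hε : 0 ≤ ε) {Q : Measure (EuclideanSpace ℝ (Fin k))} (hQ : Q ∈ ambiguitySet Ξ ξs ε) :
    ∫ ξ in Ξ, v ξ ∂Q ≤ lam * ε ^ 2 + 1 / (N : ℝ) * ∑ i, envelope v Ξ lam (ξs i) := by
  obtain ⟨⟨hQp, hQΞ, -⟩, hW⟩ := hQ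
  have hΞm : MeasurableSet Ξ := hΞ.isClosed.measurableSet
  have key (δ : ℝ) (hδ : 0 < δ) :
      ∫ ξ in Ξ, v ξ ∂Q ≤ lam * (ε + δ) ^ 2 + 1 / (N : ℝ) * ∑ i, envelope v Ξ lam (ξs i) := by
    have hlt : wasserstein Q (empirical ξs) < ENNReal.ofReal (ε + δ) :=
      hW.trans_lt ((ENNReal.ofReal_lt_ofReal_iff (by linarith)).2 (by linarith))
    simp only [wasserstein, iInf_lt_iff, mem_ofPred_eq] at hlt
    obtain ⟨γ, ⟨hγ1, hγ2⟩, hcost⟩ := hlt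
    have hγp : IsProbabilityMeasure γ := by
      constructor
      rw [← hQp.measure_univ, ← hγ1, Measure.map_apply measurable_fst .univ, preimage_univ]
    have hcost2 : ∫⁻ p, ‖p.1 - p.2‖ₑ ^ 2 ∂γ < ENNReal.ofReal ((ε + δ) ^ 2) := by
      have := ENNReal.rpow_lt_rpow hcost (z := 2) (by norm_num)
      rw [← ENNReal.rpow_mul] at this
      norm_num at this
      rwa [← ENNReal.ofReal_pow (by linarith)] at this
    simp only [enorm_sq_eq_ofReal_norm_sq] at hcost2
    have hci : Integrable (fun p => ‖p.1 - p.2‖ ^ 2) γ := by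
      refine ⟨by fun_prop, ?_⟩
      rw [hasFiniteIntegral_iff_ofReal (ae_of_all _ fun p => by positivity)]
      exact hcost2.trans ENNReal.ofReal_lt_top
    have hcle : ∫ p, ‖p.1 - p.2‖ ^ 2 ∂γ ≤ (ε + δ) ^ 2 := by
      rw [← ofReal_integral_eq_lintegral_ofReal hci (ae_of_all _ fun p => by positivity)] at hcost2
      exact ((ENNReal.ofReal_lt_ofReal_iff_of_nonneg (integral_nonneg fun p => by positivity)).1
        hcost2).le
    have hmem : ∀ᵐ p ∂γ, p.1 ∈ Ξ := ae_mem_of_map_eq measurable_fst hγ1 hΞm hQΞ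
    have hrange : ∀ᵐ p ∂γ, p.2 ∈ range ξs := by
      refine ae_mem_of_map_eq measurable_snd hγ2 (finite_range ξs).measurableSet ?_
      simp [empirical, (finite_range ξs).measurableSet]
    have hvi : Integrable (fun p => v p.1) γ := by
      obtain ⟨R, hR⟩ := hΞ.exists_bound_of_continuousOn hv.continuousOn
      exact Integrable.of_bound (by fun_prop) R (hmem.mono fun p hp => hR _ hp)
    have hec : Continuous (envelope v Ξ lam) := continuous_envelope hv hΞ
    have hei : Integrable (fun p => envelope v Ξ lam p.2) γ := by
      obtain ⟨R, hR⟩ :=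
        (finite_range ξs).isCompact.exists_bound_of_continuousOn hec.continuousOn
      exact Integrable.of_bound (by fun_prop) R (hrange.mono fun p hp => hR _ hp)
    have h1 : ∫ ξ in Ξ, v ξ ∂Q = ∫ p, v p.1 ∂γ := by
      rw [Measure.restrict_eq_self_of_ae_mem (show ∀ᵐ ξ ∂Q, ξ ∈ Ξ from hQΞ), ← hγ1,
        integral_map measurable_fst.aemeasurable hv.aestronglyMeasurable]
    have h2 : ∫ p, envelope v Ξ lam p.2 ∂γ = 1 / (N : ℝ) * ∑ i, envelope v Ξ lam (ξs i) := by
      rw [← integral_map (φ := Prod.snd) (f := envelope v Ξ lam) measurable_snd.aemeasurable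
        hec.aestronglyMeasurable, hγ2, empirical, integral_smul_sum_dirac]
    rw [h1, ← h2]
    calc ∫ p, v p.1 ∂γ ≤ ∫ p, (lam * ‖p.1 - p.2‖ ^ 2 + envelope v Ξ lam p.2) ∂γ := by
          refine integral_mono_ae hvi ((hci.const_mul _).add hei) (hmem.mono fun p hp => ?_)
          have := (isGreatest_envelope hv hΞ hne p.2 (lam := lam)).2 (mem_image_of_mem _ hp)
          simp only at this ⊢
          linarith
      _ = lam * ∫ p, ‖p.1 - p.2‖ ^ 2 ∂γ + ∫ p, envelope v Ξ lam p.2 ∂γ := by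
          rw [integral_add (hci.const_mul _) hei, integral_const_mul]
      _ ≤ _ := by gcongr
  have hlim : Tendsto (fun δ : ℝ => lam * (ε + δ) ^ 2 + 1 / (N : ℝ) * ∑ i, envelope v Ξ lam (ξs i))
      (𝓝[>] 0) (𝓝 (lam * (ε + 0) ^ 2 + 1 / (N : ℝ) * ∑ i, envelope v Ξ lam (ξs i))) :=
    (Continuous.tendsto (by fun_prop) 0).mono_left nhdsWithin_le_nhds
  rw [add_zero] at hlim
  exact ge_of_tendsto hlim (eventually_mem_nhdsWithin.mono key)

/-- The pairs (transport cost, expectation of `v`) realized by the transport plans that carry the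
empirical distribution into `Ξ`. -/
def costValuePairs (v : EuclideanSpace ℝ (Fin k) → ℝ) (Ξ : Set (EuclideanSpace ℝ (Fin k)))
    (ξs : Fin N → EuclideanSpace ℝ (Fin k)) : Set (ℝ × ℝ) :=
  {q | ∃ γ : Measure (EuclideanSpace ℝ (Fin k) × EuclideanSpace ℝ (Fin k)),
    γ.map Prod.snd = empirical ξs ∧ (∀ᵐ p ∂γ, p.1 ∈ Ξ) ∧
    Integrable (fun p => ‖p.1 - p.2‖ ^ 2) γ ∧ Integrable (fun p => v p.1) γ ∧
    ∫ p, ‖p.1 - p.2‖ ^ 2 ∂γ = q.1 ∧ ∫ p, v p.1 ∂γ = q.2}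

theorem convex_costValuePairs : Convex ℝ (costValuePairs v Ξ ξs) := by
  rintro q ⟨γ, h1, h2, h3, h4, h5, h6⟩ q' ⟨γ', h1', h2', h3', h4', h5', h6'⟩ s t hs ht hst
  refine ⟨ENNReal.ofReal s • γ + ENNReal.ofReal t • γ', ?_, ?_, ?_, ?_, ?_, ?_⟩
  · rw [Measure.map_add _ _ measurable_snd, Measure.map_smul, Measure.map_smul, h1, h1',
      ← add_smul, ← ENNReal.ofReal_add hs ht, hst, ENNReal.ofReal_one, one_smul]
  · rw [ae_add_measure_iff]
    exact ⟨Measure.ae_smul_measure h2 _, Measure.ae_smul_measure h2' _⟩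
  · exact (h3.smul_measure ENNReal.ofReal_ne_top).add_measure
      (h3'.smul_measure ENNReal.ofReal_ne_top)
  · exact (h4.smul_measure ENNReal.ofReal_ne_top).add_measure
      (h4'.smul_measure ENNReal.ofReal_ne_top)
  · rw [integral_add_measure (h3.smul_measure ENNReal.ofReal_ne_top)
      (h3'.smul_measure ENNReal.ofReal_ne_top), integral_smul_measure, integral_smul_measure,
      ENNReal.toReal_ofReal hs, ENNReal.toReal_ofReal ht, h5, h5']
    rfl
  · rw [integral_add_measure (h4.smul_measure ENNReal.ofReal_ne_top)
      (h4'.smul_measure ENNReal.ofReal_ne_top), integral_smul_measure, integral_smul_measure,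
      ENNReal.toReal_ofReal hs, ENNReal.toReal_ofReal ht, h6, h6']
    rfl

theorem pairing_mem_costValuePairs (hΞ : MeasurableSet Ξ)
    {ζ : Fin N → EuclideanSpace ℝ (Fin k)} (hζ : ∀ i, ζ i ∈ Ξ) :
    (1 / (N : ℝ) * ∑ i, ‖ζ i - ξs i‖ ^ 2, 1 / (N : ℝ) * ∑ i, v (ζ i)) ∈
      costValuePairs v Ξ ξs := by
  rcases Nat.eq_zero_or_pos N with rfl | hN
  · refine ⟨0, ?_, by simp, by simp, by simp, by simp, by simp⟩
    simp [empirical]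
  have hint (f : EuclideanSpace ℝ (Fin k) × EuclideanSpace ℝ (Fin k) → ℝ) :
      Integrable f (pairing ζ ξs) :=
    (integrable_finsetSum_measure.2 fun i _ => integrable_dirac (by simp)).smul_measure
      (by simp [hN.ne'])
  refine ⟨pairing ζ ξs, map_pairing measurable_snd ζ ξs, Measure.ae_smul_measure ?_ _, hint _,
    hint _, integral_smul_sum_dirac _ _, integral_smul_sum_dirac _ _⟩
  rw [ae_iff, Measure.finsetSum_apply]
  refine Finset.sum_eq_zero fun i _ => ?_
  rw [← ae_iff, ae_dirac_iff (measurable_fst hΞ)]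
  exact hζ i

/-- A transport plan of cost at most `ε²` certifies that its first marginal lies in the ambiguity
set. -/
theorem exists_mem_ambiguitySet (hN : 0 < N) (hv : Continuous v) (hΞ : IsCompact Ξ)
    (hne : Ξ.Nonempty) (hε : 0 ≤ ε) {q : ℝ × ℝ} (hq : q ∈ costValuePairs v Ξ ξs)
    (hqε : q.1 ≤ ε ^ 2) :
    ∃ Q ∈ ambiguitySet Ξ ξs ε, ∫ ξ in Ξ, v ξ ∂Q = q.2 := by
  obtain ⟨γ, h1, h2, h3, h4, h5, h6⟩ := hq
  have hΞm : MeasurableSet Ξ := hΞ.isClosed.measurableSet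
  have := isProbabilityMeasure_empirical (ξs := ξs) hN
  have hγp : IsProbabilityMeasure γ := by
    constructor
    rw [← measure_univ (μ := empirical ξs), ← h1, Measure.map_apply measurable_snd .univ,
      preimage_univ]
  have hQp : IsProbabilityMeasure (γ.map Prod.fst) :=
    Measure.isProbabilityMeasure_map measurable_fst.aemeasurable
  have hQΞ : ∀ᵐ ξ ∂(γ.map Prod.fst), ξ ∈ Ξ :=
    (ae_map_iff measurable_fst.aemeasurable hΞm).2 h2
  refine ⟨γ.map Prod.fst, ⟨⟨hQp, hQΞ, ?_⟩, ?_⟩, ?_⟩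
  · obtain ⟨p, hp⟩ := hne
    refine ⟨p, hp, ?_⟩
    have hc : Continuous fun ξ : EuclideanSpace ℝ (Fin k) => ‖ξ - p‖ ^ 2 := by fun_prop
    obtain ⟨R, hR⟩ := hΞ.exists_bound_of_continuousOn hc.continuousOn
    have hi : Integrable (fun ξ => ‖ξ - p‖ ^ 2) (γ.map Prod.fst) :=
      Integrable.of_bound hc.aestronglyMeasurable R (hQΞ.mono fun ξ hξ => hR ξ hξ)
    simp only [enorm_sq_eq_ofReal_norm_sq]
    rw [← hasFiniteIntegral_iff_ofReal (ae_of_all _ fun ξ => by positivity)]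
    exact hi.2
  · refine (iInf₂_le γ ⟨rfl, h1⟩).trans ?_
    simp only [enorm_sq_eq_ofReal_norm_sq]
    rw [← ofReal_integral_eq_lintegral_ofReal h3 (ae_of_all _ fun p => by positivity), h5]
    refine (ENNReal.rpow_le_rpow (ENNReal.ofReal_le_ofReal hqε) (by norm_num)).trans ?_
    rw [ENNReal.ofReal_rpow_of_nonneg (by positivity) (by norm_num), ← Real.sqrt_eq_rpow,
      Real.sqrt_sq hε]
  · rw [Measure.restrict_eq_self_of_ae_mem hQΞ,
      integral_map measurable_fst.aemeasurable hv.aestronglyMeasurable, h6]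

/-- Strong Lagrangian duality. Since `ε > 0`, the plan of zero cost is a Slater point; separating
the convex set of attainable (cost, value) pairs from the quadrant `cost < ε²`, `value > V` in the
plane yields the multiplier. -/
theorem exists_multiplier (hN : 0 < N) (hv : Continuous v) (hΞ : IsCompact Ξ) (hε : 0 < ε)
    (hξs : ∀ i, ξs i ∈ Ξ) {V : ℝ}
    (hV : ∀ Q ∈ ambiguitySet Ξ ξs ε, ∫ ξ in Ξ, v ξ ∂Q ≤ V) :
    ∃ lam : ℝ, 0 ≤ lam ∧ lam * ε ^ 2 + 1 / (N : ℝ) * ∑ i, envelope v Ξ lam (ξs i) ≤ V := by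
  have hne : Ξ.Nonempty := ⟨_, hξs ⟨0, hN⟩⟩
  have hΞm : MeasurableSet Ξ := hΞ.isClosed.measurableSet
  have hdisj : Disjoint (Iio (ε ^ 2) ×ˢ Ioi V) (costValuePairs v Ξ ξs) := by
    rw [Set.disjoint_left]
    rintro q ⟨hq1, hq2⟩ hq
    obtain ⟨Q, hQ, hQq⟩ := exists_mem_ambiguitySet hN hv hΞ hne hε.le hq (le_of_lt hq1)
    exact absurd (hV Q hQ) (not_le.2 (hQq ▸ hq2))
  obtain ⟨f, u, hfu, huf⟩ := geometric_hahn_banach_open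
    ((convex_Iio (ε ^ 2)).prod (convex_Ioi V)) (isOpen_Iio.prod isOpen_Ioi)
    convex_costValuePairs hdisj
  have hf (a c : ℝ) : f (a, c) = a * f (1, 0) + c * f (0, 1) := by
    rw [← smul_eq_mul, ← smul_eq_mul, ← map_smul, ← map_smul, ← map_add]
    simp
  generalize f (1, 0) = p at hf
  generalize f (0, 1) = q at hf
  have hfu' (s t : ℝ) (hs : 0 < s) (ht : 0 < t) : (ε ^ 2 - s) * p + (V + t) * q < u := by
    rw [← hf]
    exact hfu _ ⟨by simpa using hs, by simpa using ht⟩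
  have hε2 : 0 < ε ^ 2 := by positivity
  have hp : 0 ≤ p := by
    by_contra! h
    -- a cost tending to `-∞` would make the functional exceed `u`
    have h1 := hfu' (1 + (|u - ε ^ 2 * p - (V + 1) * q|) / (-p)) 1
      (by have := div_nonneg (abs_nonneg (u - ε ^ 2 * p - (V + 1) * q)) (neg_pos.2 h).le
          linarith) one_pos
    have h2 : |u - ε ^ 2 * p - (V + 1) * q| / (-p) * p = -|u - ε ^ 2 * p - (V + 1) * q| := by
      field_simp [h.ne]
    nlinarith [le_abs_self (u - ε ^ 2 * p - (V + 1) * q)]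
  have hq : q ≤ 0 := by
    by_contra! h
    -- likewise for a value tending to `+∞`
    have h1 := hfu' 1 (1 + |u - (ε ^ 2 - 1) * p - V * q| / q)
      one_pos (by positivity)
    have h2 : |u - (ε ^ 2 - 1) * p - V * q| / q * q = |u - (ε ^ 2 - 1) * p - V * q| :=
      div_mul_cancel₀ _ h.ne'
    nlinarith [le_abs_self (u - (ε ^ 2 - 1) * p - V * q)]
  have hslater := huf _ (pairing_mem_costValuePairs (v := v) (ξs := ξs) hΞm hξs)
  rw [hf] at hslater
  simp only [sub_self, norm_zero, ne_eq, OfNat.ofNat_ne_zero, not_false_eq_true, zero_pow,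
    Finset.sum_const_zero, mul_zero, zero_mul, zero_add] at hslater
  -- the plan of zero cost excludes a vertical separating line
  have hq' : q < 0 := by
    refine lt_of_le_of_ne hq fun h => ?_
    have h1 := hfu' (ε ^ 2) 1 hε2 one_pos
    subst h
    linarith
  have hlim : ε ^ 2 * p + V * q ≤ u := by
    refine le_of_forall_pos_le_add fun δ hδ => ?_
    have hs : 0 < δ / (p - q) := div_pos hδ (by linarith)
    have h1 := hfu' _ _ hs hs
    have h2 : δ / (p - q) * (p - q) = δ := div_mul_cancel₀ _ (by linarith)
    linarith
  -- the plan sending each `ξ̂ᵢ` to a maximizer of its envelope turns separation into the bound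
  choose ζ hζ hζe using fun i =>
    (isGreatest_envelope hv hΞ hne (ξs i) (lam := p / (-q))).1
  have h1 := huf _ (pairing_mem_costValuePairs (v := v) (ξs := ξs) hΞm hζ)
  rw [hf] at h1
  refine ⟨p / (-q), div_nonneg hp (by linarith), ?_⟩
  have hsum : 1 / (N : ℝ) * ∑ i, envelope v Ξ (p / (-q)) (ξs i) =
      1 / (N : ℝ) * ∑ i, v (ζ i) - p / (-q) * (1 / (N : ℝ) * ∑ i, ‖ζ i - ξs i‖ ^ 2) := by
    simp only [← hζe, Finset.sum_sub_distrib, ← Finset.mul_sum]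
    ring
  rw [hsum]
  generalize 1 / (N : ℝ) * ∑ i, v (ζ i) = c at h1
  generalize 1 / (N : ℝ) * ∑ i, ‖ζ i - ξs i‖ ^ 2 = a at h1
  have h2 : p / (-q) * (-q) = p := div_mul_cancel₀ _ (by linarith)
  generalize p / (-q) = l at h2
  subst h2
  nlinarith

end Wasserstein

/-! ### Exactness of the copositive program -/

section Copositive

variable {m n k N : ℕ} [NeZero k] {A : Matrix (Fin m) (Fin n) ℝ} {b : Fin m → ℝ}
  {B : Finset (Fin n)} {F : Matrix (Fin n) (Fin k) ℝ}
  {C : ProperCone ℝ (EuclideanSpace ℝ (Fin k))} {ξs : Fin N → EuclideanSpace ℝ (Fin k)}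

/-- Copositivity at the points `(ξ, x)` with `ξ ∈ Ξ` and `x ∈ X` bounds the envelope. -/
theorem envelope_le_of_copFeasible (hΞ_ne : (supportSet C).Nonempty)
    (hX_ne : (feasibleSet A b B).Nonempty) (hX_bdd : Bornology.IsBounded (feasibleSet A b B))
    {r : ℝ} (hr : RedundantBound (supportSet C) (feasibleSet A b B) r) {y : CopVars m N B}
    (hy : y ∈ copFeasible A b B F C ξs) (i : Fin N) :
    envelope (optValue A b B F) (supportSet C) y.lam (ξs i) ≤ y.α i + r * y.ρ i := by
  refine csSup_le (hΞ_ne.image _) ?_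
  rintro _ ⟨ξ, hξ, rfl⟩
  obtain ⟨x, hx, hxv⟩ := (isGreatest_optValue hX_ne hX_bdd F ξ).1
  have h1 := (hy.1 i).2 _ ⟨ξ, hξ.1, x, hx.2.1, rfl⟩
  have hB0 : ∑ j : B, y.v i j * (x j ^ 2 - x j * 1) = 0 := by
    refine Finset.sum_eq_zero fun j _ => ?_
    rcases hx.2.2 j j.2 with h | h <;> simp [h]
  rw [quadForm_copMatrix, hξ.2, hx.1, hB0] at h1
  have h2 := mul_le_mul_of_nonneg_left (hr ξ hξ x hx) (hy.2.1 i)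
  simp only [one_mul, sub_self, ne_eq, OfNat.ofNat_ne_zero, not_false_eq_true, zero_pow, mul_zero,
    Finset.sum_const_zero, one_pow, mul_one, add_zero, one_smul] at h1
  simp only at hxv ⊢
  linarith

/-- For `α` above the envelope, large penalties `u = t` and `v = -s` with `ρ = 0` make the
constraint matrix copositive.

The form is homogeneous, so it suffices to treat the compact unit sphere of the cone. The penalty
`s` is chosen first, on the part where `A x = ξ₁ b`: there `ξ₁ > 0`, rescaling to `ξ₁ = 1` gives
`0 ≤ x_j ≤ ξ₁` for `j ∈ B`, so `∑ x_j (ξ₁ - x_j)` is a nonnegative penalty whose zeros rescale to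
`Ξ × X`. The penalty `t` on `‖A x - ξ₁ b‖²` then handles the rest of the sphere. -/
theorem exists_penalties (hC_first : ∀ ξ ∈ C, 0 ≤ ξ 0) (hΞ_ne : (supportSet C).Nonempty)
    (hΞ_bdd : Bornology.IsBounded (supportSet C)) (hX_ne : (feasibleSet A b B).Nonempty)
    (hX_bdd : Bornology.IsBounded (feasibleSet A b B))
    (hB : ∀ x : Fin n → ℝ, A *ᵥ x = b → 0 ≤ x → ∀ j ∈ B, 0 ≤ x j ∧ x j ≤ 1)
    {lam α : ℝ} {η : EuclideanSpace ℝ (Fin k)}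
    (hα : envelope (optValue A b B F) (supportSet C) lam η < α) :
    ∃ s t : ℝ, ∀ ξ ∈ C, ∀ x : Fin n → ℝ, 0 ≤ x →
      0 ≤ α * ξ 0 ^ 2 - ((F *ᵥ ξ.ofLp) ⬝ᵥ x - lam * ‖ξ - ξ 0 • η‖ ^ 2)
        + s * ∑ j : B, x j * (ξ 0 - x j) + t * ∑ l, ((A *ᵥ x) l - ξ 0 * b l) ^ 2 := by
  set f : EuclideanSpace ℝ (Fin k) × (Fin n → ℝ) → ℝ := fun z =>
    α * z.1 0 ^ 2 - ((F *ᵥ z.1.ofLp) ⬝ᵥ z.2 - lam * ‖z.1 - z.1 0 • η‖ ^ 2) with hf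
  set g : EuclideanSpace ℝ (Fin k) × (Fin n → ℝ) → ℝ := fun z =>
    ∑ j : B, z.2 j * (z.1 0 - z.2 j) with hg
  set h : EuclideanSpace ℝ (Fin k) × (Fin n → ℝ) → ℝ := fun z =>
    ∑ l, ((A *ᵥ z.2) l - z.1 0 * b l) ^ 2 with hh
  have hobj := continuous_objective F
  have hfc : Continuous f := by fun_prop
  have hgc : Continuous g := by fun_prop
  have hhc : Continuous h := by fun_prop
  have hfs (c : ℝ) (z) : f (c • z) = c ^ 2 * f z := by
    simp only [hf, Prod.smul_fst, Prod.smul_snd, PiLp.smul_apply, WithLp.ofLp_smul, mulVec_smul,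
      smul_dotProduct, dotProduct_smul, smul_eq_mul, mul_smul, ← smul_sub, norm_smul, mul_pow,
      Real.norm_eq_abs, sq_abs]
    ring
  have hgs (c : ℝ) (z) : g (c • z) = c ^ 2 * g z := by
    simp only [hg, Prod.smul_fst, Prod.smul_snd, PiLp.smul_apply, Pi.smul_apply, smul_eq_mul,
      Finset.mul_sum]
    exact Finset.sum_congr rfl fun j _ => by ring
  have hhs (c : ℝ) (z) : h (c • z) = c ^ 2 * h z := by
    simp only [hh, Prod.smul_fst, Prod.smul_snd, PiLp.smul_apply, mulVec_smul, Pi.smul_apply,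
      smul_eq_mul, Finset.mul_sum]
    exact Finset.sum_congr rfl fun j _ => by ring
  set S : Set (EuclideanSpace ℝ (Fin k) × (Fin n → ℝ)) :=
    ((C : Set (EuclideanSpace ℝ (Fin k))) ×ˢ Ici 0) ∩ Metric.sphere 0 1 with hS
  have hSc : IsCompact S := (isCompact_sphere _ _).inter_left (C.isClosed.prod isClosed_Ici)
  have hh0 (z) : h z = 0 ↔ A *ᵥ z.2 = z.1 0 • b := by
    simp only [hh, Finset.sum_eq_zero_iff_of_nonneg fun l _ => sq_nonneg _, Finset.mem_univ,
      true_imp_iff, sq_eq_zero_iff, sub_eq_zero, funext_iff, Pi.smul_apply, smul_eq_mul]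
  -- on the sphere, `A x = ξ₁ b` excludes `ξ₁ = 0`, so that the point can be rescaled to the slice
  have hslice (z) (hz : z ∈ S) (hz0 : h z = 0) : 0 < z.1 0 ∧
      (z.1 0)⁻¹ • z.1 ∈ supportSet C ∧ A *ᵥ ((z.1 0)⁻¹ • z.2) = b ∧ 0 ≤ (z.1 0)⁻¹ • z.2 := by
    rw [hh0] at hz0
    have hpos : 0 < z.1 0 := by
      refine lt_of_le_of_ne (hC_first _ hz.1.1) fun h0 => ?_
      have h1 : z.1 = 0 := eq_zero_of_mem_cone hΞ_ne hΞ_bdd hz.1.1 h0.symm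
      have h2 : z.2 = 0 := by
        refine eq_zero_of_mulVec_eq_zero hX_ne hX_bdd hB ?_ hz.1.2
        rw [hz0, ← h0, zero_smul]
      have h3 : z = 0 := Prod.ext h1 h2
      simpa [h3] using hz.2
    have hinv : 0 ≤ (z.1 0)⁻¹ := (inv_pos.2 hpos).le
    refine ⟨hpos, ⟨C.smul_mem hz.1.1 hinv, ?_⟩, ?_, smul_nonneg hinv hz.1.2⟩
    · simp [hpos.ne']
    · rw [mulVec_smul, hz0, inv_smul_smul₀ hpos.ne']
  have hbin (z) (hz : z ∈ S) (hz0 : h z = 0) (j : B) : 0 ≤ z.2 j * (z.1 0 - z.2 j) := by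
    obtain ⟨hpos, -, hA, hx⟩ := hslice z hz hz0
    refine mul_nonneg (hz.1.2 j) (sub_nonneg.2 ?_)
    have := (hB _ hA hx j j.2).2
    rwa [Pi.smul_apply, smul_eq_mul, inv_mul_le_one₀ hpos] at this
  obtain ⟨s, -, hs⟩ := exists_penalty (S := S ∩ {z | h z = 0}) (f := f) (g := g)
    (hSc.inter_right (isClosed_eq hhc continuous_const)) hfc hgc
    (fun z hz => Finset.sum_nonneg fun j _ => hbin z hz.1 hz.2 j) fun z hz hgz => by
      obtain ⟨hpos, hξ, hA, hx⟩ := hslice z hz.1 hz.2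
      have hX : (z.1 0)⁻¹ • z.2 ∈ feasibleSet A b B := by
        refine ⟨hA, hx, fun j hj => ?_⟩
        have h1 := (Finset.sum_eq_zero_iff_of_nonneg fun j _ => hbin z hz.1 hz.2 j).1 hgz
          ⟨j, hj⟩ (Finset.mem_univ _)
        rcases mul_eq_zero.1 h1 with h2 | h2
        · left
          simp only at h2
          simp [h2]
        · right
          rw [sub_eq_zero] at h2
          simp only at h2
          simp [← h2, hpos.ne']
      have h1 := (isGreatest_optValue hX_ne hX_bdd F ((z.1 0)⁻¹ • z.1)).2
        (mem_image_of_mem _ hX)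
      have h2 := (isGreatest_envelope (lam := lam) (continuous_optValue hX_bdd F)
        (isCompact_supportSet hΞ_bdd) hΞ_ne η).2 (mem_image_of_mem _ hξ)
      have h3 : 0 < f ((z.1 0)⁻¹ • z) := by
        have h4 : ((z.1 0)⁻¹ • z.1) 0 = 1 := hξ.2
        simp only [hf, h4, one_smul, Prod.smul_fst, Prod.smul_snd] at h1 h2 ⊢
        linarith
      rw [hfs] at h3
      exact (pos_iff_pos_of_mul_pos h3).1 (by positivity)
  obtain ⟨t, -, ht⟩ := exists_penalty (S := S) (f := fun z => f z + s * g z) (g := h) hSc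
    (by fun_prop) hhc (fun z _ => Finset.sum_nonneg fun l _ => sq_nonneg _)
    fun z hz hz0 => hs z ⟨hz, hz0⟩
  refine ⟨s, t, fun ξ hξ x hx => ?_⟩
  change 0 ≤ f (ξ, x) + s * g (ξ, x) + t * h (ξ, x)
  rcases eq_or_ne (ξ, x) (0 : EuclideanSpace ℝ (Fin k) × (Fin n → ℝ)) with h0 | h0
  · rw [h0, ← zero_smul ℝ (0 : EuclideanSpace ℝ (Fin k) × (Fin n → ℝ)), hfs, hgs, hhs]
    simp
  · have hn : 0 < ‖(ξ, x)‖ := norm_pos_iff.2 h0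
    have hinv : 0 ≤ ‖(ξ, x)‖⁻¹ := (inv_pos.2 hn).le
    have h1 := ht (‖(ξ, x)‖⁻¹ • (ξ, x)) ⟨⟨C.smul_mem hξ hinv, smul_nonneg hinv hx⟩, by
      rw [mem_sphere_zero_iff_norm, norm_smul, norm_inv, norm_norm, inv_mul_cancel₀ hn.ne']⟩
    simp only [hfs, hgs, hhs] at h1
    have h2 : 0 < ‖(ξ, x)‖⁻¹ ^ 2 * (f (ξ, x) + s * g (ξ, x) + t * h (ξ, x)) := by linarith
    exact ((pos_iff_pos_of_mul_pos h2).1 (by positivity)).le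

theorem exists_copFeasible (hC_first : ∀ ξ ∈ C, 0 ≤ ξ 0) (hΞ_ne : (supportSet C).Nonempty)
    (hΞ_bdd : Bornology.IsBounded (supportSet C)) (hX_ne : (feasibleSet A b B).Nonempty)
    (hX_bdd : Bornology.IsBounded (feasibleSet A b B))
    (hB : ∀ x : Fin n → ℝ, A *ᵥ x = b → 0 ≤ x → ∀ j ∈ B, 0 ≤ x j ∧ x j ≤ 1)
    {lam : ℝ} (hlam : 0 ≤ lam) {α : Fin N → ℝ}
    (hα : ∀ i, envelope (optValue A b B F) (supportSet C) lam (ξs i) < α i) :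
    ∃ y ∈ copFeasible A b B F C ξs, y.lam = lam ∧ y.α = α ∧ y.ρ = 0 := by
  choose s t hst using fun i =>
    exists_penalties hC_first hΞ_ne hΞ_bdd hX_ne hX_bdd hB (hα i)
  refine ⟨⟨lam, α, 0, fun i _ => t i, fun i _ => -s i⟩, ⟨fun i => ⟨isSymm_copMatrix .., ?_⟩,
    fun i => le_rfl, hlam⟩, rfl, rfl, rfl⟩
  rintro _ ⟨ξ, hξ, x, hx, rfl⟩
  have h1 := hst i ξ hξ x hx
  rw [quadForm_copMatrix]
  simp only [Finset.mul_sum, Pi.zero_apply, zero_mul, add_zero] at h1 ⊢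
  refine h1.trans_eq ?_
  rw [add_right_comm]
  congr 1
  exact Finset.sum_congr rfl fun j _ => by ring

end Copositive

end WassersteinCop

theorem mainTheorem1 {m n k N : ℕ} [NeZero k] (hN : 0 < N)
    (A : Matrix (Fin m) (Fin n) ℝ) (b : Fin m → ℝ) (B : Finset (Fin n))
    (F : Matrix (Fin n) (Fin k) ℝ)
    (C : ProperCone ℝ (EuclideanSpace ℝ (Fin k)))
    (hC_first : ∀ ξ ∈ C, 0 ≤ ξ 0)
    (hC_full : (interior (C : Set (EuclideanSpace ℝ (Fin k)))).Nonempty)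
    (hΞ_ne : (WassersteinCop.supportSet C).Nonempty)
    (hΞ_bdd : Bornology.IsBounded (WassersteinCop.supportSet C))
    (hX_ne : (WassersteinCop.feasibleSet A b B).Nonempty)
    (hX_bdd : Bornology.IsBounded (WassersteinCop.feasibleSet A b B))
    (hB : ∀ x : Fin n → ℝ, A *ᵥ x = b → 0 ≤ x → ∀ j ∈ B, 0 ≤ x j ∧ x j ≤ 1)
    (ξs : Fin N → EuclideanSpace ℝ (Fin k))
    (hξs : ∀ i, ξs i ∈ WassersteinCop.supportSet C)
    (ε : ℝ) (hε : 0 < ε) :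
    -- the inner maximum, the expectations and the worst-case value are well defined
    (∀ ξ ∈ WassersteinCop.supportSet C,
      IsGreatest (WassersteinCop.objectiveValues A b B F ξ)
        (WassersteinCop.optValue A b B F ξ)) ∧
    (∀ Q ∈ WassersteinCop.ambiguitySet (WassersteinCop.supportSet C) ξs ε,
      IntegrableOn (WassersteinCop.optValue A b B F) (WassersteinCop.supportSet C) Q) ∧
    IsLUB (WassersteinCop.expectedValues A b B F (WassersteinCop.supportSet C) ξs ε)
      (WassersteinCop.worstCaseValue A b B F (WassersteinCop.supportSet C) ξs ε) ∧
    -- admissible constants `r` exist, and for each of them the copositive program is exact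
    (∃ r : ℝ, 0 < r ∧ WassersteinCop.RedundantBound (WassersteinCop.supportSet C)
      (WassersteinCop.feasibleSet A b B) r) ∧
    ∀ r : ℝ, 0 < r →
      WassersteinCop.RedundantBound (WassersteinCop.supportSet C)
        (WassersteinCop.feasibleSet A b B) r →
      IsGLB (WassersteinCop.copObjective ε r '' WassersteinCop.copFeasible A b B F C ξs)
        (WassersteinCop.worstCaseValue A b B F (WassersteinCop.supportSet C) ξs ε) := by
  have hX := WassersteinCop.isCompact_feasibleSet hX_bdd
  have hΞ := WassersteinCop.isCompact_supportSet hΞ_bdd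
  have hv := WassersteinCop.continuous_optValue hX_bdd F
  have hdual (lam : ℝ) (hlam : 0 ≤ lam) : lam * ε ^ 2 + 1 / (N : ℝ) * ∑ i,
      WassersteinCop.envelope (WassersteinCop.optValue A b B F) (WassersteinCop.supportSet C) lam
        (ξs i) ∈ upperBounds
      (WassersteinCop.expectedValues A b B F (WassersteinCop.supportSet C) ξs ε) := by
    rintro _ ⟨Q, hQ, rfl⟩
    exact WassersteinCop.integral_le_dual hv hΞ hΞ_ne hlam hε.le hQ
  have hlub : IsLUB (WassersteinCop.expectedValues A b B F (WassersteinCop.supportSet C) ξs ε)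
      (WassersteinCop.worstCaseValue A b B F (WassersteinCop.supportSet C) ξs ε) := by
    refine isLUB_csSup ?_ ⟨_, hdual 0 le_rfl⟩
    obtain ⟨Q, hQ, -⟩ := WassersteinCop.exists_mem_ambiguitySet hN hv hΞ hΞ_ne hε.le
      (WassersteinCop.pairing_mem_costValuePairs (ξs := ξs) hΞ.isClosed.measurableSet hξs)
      (by simpa using sq_nonneg ε)
    exact ⟨_, Q, hQ, rfl⟩
  refine ⟨fun ξ _ => WassersteinCop.isGreatest_optValue hX_ne hX_bdd F ξ, fun Q hQ => ?_, hlub,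
    WassersteinCop.exists_redundantBound hΞ hX, fun r _ hr => ⟨?_, fun l hl => ?_⟩⟩
  · have := hQ.1.1
    exact hv.continuousOn.integrableOn_compact hΞ
  · rintro _ ⟨y, hy, rfl⟩
    refine (hlub.2 (hdual y.lam hy.2.2)).trans ?_
    unfold WassersteinCop.copObjective
    gcongr with i
    exact WassersteinCop.envelope_le_of_copFeasible hΞ_ne hX_ne hX_bdd hr hy i
  · obtain ⟨lam, hlam, hle⟩ := WassersteinCop.exists_multiplier hN hv hΞ hε hξs
      fun Q hQ => hlub.1 ⟨Q, hQ, rfl⟩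
    -- raising the envelope by `δ` makes it strictly exceeded, at the price `δ` in the objective
    refine le_of_forall_pos_le_add fun δ hδ => ?_
    obtain ⟨y, hy, hy1, hy2, hy3⟩ := WassersteinCop.exists_copFeasible (F := F) (ξs := ξs)
      hC_first hΞ_ne hΞ_bdd hX_ne hX_bdd hB hlam fun i => lt_add_of_pos_right
        (WassersteinCop.envelope (WassersteinCop.optValue A b B F) (WassersteinCop.supportSet C) lam
          (ξs i)) hδ
    refine (hl ⟨y, hy, rfl⟩).trans ((le_of_eq ?_).trans (add_le_add_left hle δ))
    have hN' : (N : ℝ) ≠ 0 := by exact_mod_cast hN.ne'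
    simp only [WassersteinCop.copObjective, hy1, hy2, hy3, Pi.zero_apply, mul_zero, add_zero,
      Finset.sum_add_distrib, Finset.sum_const, Finset.card_univ, Fintype.card_fin, nsmul_eq_mul]
    field_simp
    ring
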